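/- Let $H=(h_{ji})_{j\in J,\,i\in I}$ be a binary matrix with finite index sets such that every column contains exactly two ones, i.e. $H$ is a parity-check matrix of a cycle code $C$; put $I_j=\{i : h_{ji}=1\}$. The Tanner graph $T(H)$ has bit nodes $i\in I$ and check nodes $j\in J$, with $i$ adjacent to $j$ iff $h_{ji}=1$. The normal graph $N=N(H)$ has vertex set $J$ and, for each $i\in I$, one edge $e_i$ joining the two checks $j$ with $h_{ji}=1$. For $M\ge 1$, an $M$-cover of $T(H)$ is a graph $\widetilde T$ with a surjective graph homomorphism $\pi:\widetilde T\to T(H)$ that maps the neighbourhood of each vertex $y$ bijectively to the neighbourhood of $\pi(y)$ and all of whose fibres have exactly $M$ elements. A codeword $\tilde c$ of $\widetilde T$ assigns a value in $\mathbb F_2$ to each vertex over a bit node so that the values at the neighbours of each vertex over a check node sum to $0$. A vector $p\in\mathbb N_0^I$ is an unscaled pseudo-codeword of $C$ if for some $M\ge1$, some $M$-cover and some codeword $\tilde c$, each $p_i$ is the integer sum of the values of $\tilde c$ over the fibre of the bit node $i$. A cycle in $N$ is a nonempty edge sequence $\Gamma=(e_{i_1},\dots,e_{i_k})$ whose edges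 can be directed so that each terminates where the next begins and the last terminates where the first begins. It is backtrackless if $e_{i_s}\ne e_{i_{s+1}}$ for $1\le s<k$, tailless if $e_{i_1}\neq e_{i_k}$, and primitive if it is not $\Theta^r$ for a cycle $\Theta$ and $r\ge2$. Let $A(N)$ be the set of classes, up to cyclic rotation, of backtrackless tailless primitive cycles, let $g(\Gamma)=u_{i_1}\cdots u_{i_k}$, and let $$\zeta_N=\prod_{[\Gamma]\in A(N)}\bigl(1-g(\Gamma)\bigr)^{-1}\in\mathbb Z[[u_i : i\in I]].$$ The fundamental cone $\mathcal K(H)\subseteq\mathbb R^I$ is the set of all $\omega$ with $\omega_i\ge0$ for all $i\in I$ and $\sum_{i'\in I_j\setminus\{i\}}\omega_{i'}\ge\omega_i$ for all $j\in J$ and $i\in I_j$. Then: 1. A vector $p\in\mathbb N_0^I$ is an unscaled pseudo-codeword of $C$ if and only if there is a combination (a finite, possibly empty collection, repetitions allowed) of backtrackless tailless cycles in $N$ that together use the edge $e_i$ exactly $p_i$ times for every $i\in I$. Moreover, there is a single backtrackless tailless cycle in $N$ that uses each edge $e_i$ exactly $p_i$ times if and only if $p$ is an unscaled pseudo-codeword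 whose support $\{e_i : p_i>0\}$ is nonempty and connected. 2. The product that defines $\zeta_N$ converges (coefficientwise), and $p\mapsto\prod_{i}u_i^{p_i}$ is a bijection from the set of unscaled pseudo-codewords of $C$ onto the set of monomials that have nonzero coefficient in $\zeta_N$. 3. The Newton polyhedron of $\zeta_N$, i.e. the convex hull in $\mathbb R^I$ of the exponent vectors of the monomials with nonzero coefficient in $\zeta_N$, equals $\mathcal K(H)$. -/

import Mathlib

open scoped MvPowerSeries.WithPiTopology

namespace CycleCode

noncomputable section

/-! ### Parity-check matrices, Tanner graphs, cycle codes

Rows of `H` (checks) are indexed by `J`, columns of `H` (bits) are indexed by `I`. -/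

section Codes

variable {J I : Type*}

/-- The set `J_i` of the checks in which the bit `i` takes part. -/
def checksOf (H : Matrix J I (ZMod 2)) (i : I) : Set J := {j | H j i = 1}

/-- A cycle code: every bit takes part in exactly two checks. -/
def IsCycleCode (H : Matrix J I (ZMod 2)) : Prop := ∀ i, (checksOf H i).ncard = 2

/-- The Tanner graph: bit node `i` and check node `j` are adjacent iff `H j i = 1`. -/
def tannerGraph (H : Matrix J I (ZMod 2)) : SimpleGraph (I ⊕ J) where
  Adj
    | .inl i, .inr j => H j i = 1
    | .inr j, .inl i => H j i = 1
    | _, _ => False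
  symm := ⟨by rintro (i | j) (i' | j') h <;> exact h⟩
  loopless := ⟨by rintro (i | j) h <;> exact h⟩

/-- The normal graph: its vertices are the checks, and every bit `i` of degree two is an edge,
labelled `i`, that joins the two checks in which `i` takes part. -/
def normalGraph (H : Matrix J I (ZMod 2)) : Graph J I where
  vertexSet := Set.univ
  IsLink i a b := a ≠ b ∧ checksOf H i = {a, b}
  isLink_symm := fun _ _ => ⟨fun _ _ h => ⟨h.1.symm, h.2.trans (Set.pair_comm _ _)⟩⟩
  eq_or_eq_of_isLink_of_isLink := by
    rintro e x y v w ⟨-, h⟩ ⟨-, h'⟩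
    have hx : x ∈ ({v, w} : Set J) := by rw [← h', h]; exact Set.mem_insert _ _
    simpa using hx
  left_mem_of_isLink := fun _ _ _ _ => Set.mem_univ _

end Codes

/-! ### Covers and pseudo-codewords -/

section Covers

variable {V W : Type*} {X : SimpleGraph V} {Y : SimpleGraph W}

/-- An (unramified) cover of graphs: a surjective graph homomorphism that maps the neighbourhood
of each vertex `y` bijectively to the neighbourhood of the image of `y`. -/
def IsCover (π : Y →g X) : Prop :=
  Function.Surjective π ∧ ∀ y, Set.BijOn π (Y.neighborSet y) (X.neighborSet (π y))

/-- An `M`-cover: a cover all of whose fibres have exactly `M` elements. -/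
def IsMCover (M : ℕ) (π : Y →g X) : Prop :=
  IsCover π ∧ ∀ x, Finite (π ⁻¹' {x}) ∧ (π ⁻¹' {x}).ncard = M

end Covers

section PseudoCodewords

variable {J I W : Type*} {H : Matrix J I (ZMod 2)} {Y : SimpleGraph W}

/-- The bit nodes of a graph lying over a Tanner graph. -/
abbrev BitNode (π : Y →g tannerGraph H) : Type _ := {w : W // ∃ i, π w = Sum.inl i}

open scoped Classical in
/-- `c` is a codeword of the binary code described by a graph over the Tanner graph: for each of
its check nodes `w`, the values of `c` at the bit nodes adjacent to `w` sum to zero in `GF(2)`. -/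
def IsCoverCodeword [Fintype W] (π : Y →g tannerGraph H) (c : BitNode π → ZMod 2) : Prop :=
  ∀ (w : W) (j : J), π w = Sum.inr j → ∑ x ∈ Finset.univ.filter (fun x : BitNode π => Y.Adj w x.1), c x = 0

open scoped Classical in
/-- The unscaled pseudo-codeword of `c`: its entry `i` is the sum, taken over the integers, of the
values of `c` at the copies of the bit node `i`. -/
def unscaledPseudoCodeword [Fintype W] (π : Y →g tannerGraph H) (c : BitNode π → ZMod 2) (i : I) :
    ℕ :=
  ∑ x ∈ Finset.univ.filter (fun x : BitNode π => π x.1 = Sum.inl i), (c x).val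

/-- `p` is the unscaled pseudo-codeword of some codeword in the code described by some `M`-cover
of the Tanner graph of `H`, for some positive integer `M`. -/
def IsUnscaledPseudoCodeword (H : Matrix J I (ZMod 2)) (p : I → ℕ) : Prop :=
  ∃ (M : ℕ) (W : Type) (_ : Fintype W) (Y : SimpleGraph W) (π : Y →g tannerGraph H)
    (c : BitNode π → ZMod 2),
    0 < M ∧ IsMCover M π ∧ IsCoverCodeword π c ∧ ∀ i, p i = unscaledPseudoCodeword π c i

end PseudoCodewords

/-! ### The fundamental cone -/

section Cone

variable {J I : Type*}

open scoped Classical in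
/-- The fundamental cone of `H`. -/
def fundamentalCone [Fintype I] (H : Matrix J I (ZMod 2)) : Set (I → ℝ) :=
  {ω | (∀ i, 0 ≤ ω i) ∧
    ∀ j i, H j i = 1 → ω i ≤ ∑ i' : I with H j i' = 1 ∧ i' ≠ i, ω i'}

end Cone

/-! ### Cycles in graphs and the edge zeta function -/

section Zeta

variable {V E : Type*}

/-- A nonempty sequence of edges is a cycle if its edges can be directed so that each one
terminates where the next one begins, and the last one terminates where the first one begins. -/
def IsCycle (G : Graph V E) (γ : List E) : Prop :=
  γ ≠ [] ∧ ∃ v : Fin (γ.length + 1) → V, v (Fin.last _) = v 0 ∧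
    ∀ s : Fin γ.length, G.IsLink (γ.get s) (v s.castSucc) (v s.succ)

/-- No edge is immediately followed by itself. -/
def IsBacktrackless (γ : List E) : Prop := γ.IsChain (· ≠ ·)

/-- The first edge is different from the last one. -/
def IsTailless (γ : List E) : Prop := γ.head? ≠ γ.getLast?

/-- A backtrackless tailless cycle. -/
def IsBTCycle (G : Graph V E) (γ : List E) : Prop :=
  IsCycle G γ ∧ IsBacktrackless γ ∧ IsTailless γ

/-- The sequence is not obtained by following some cycle `r ≥ 2` times. -/
def IsPrimitive (G : Graph V E) (γ : List E) : Prop :=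
  ¬ ∃ (θ : List E) (r : ℕ), IsCycle G θ ∧ 2 ≤ r ∧ γ = (List.replicate r θ).flatten

/-- The set of equivalence classes, under cyclic rotation, of backtrackless tailless primitive
cycles. (The type `Cycle E` consists of the lists in `E` up to rotation.) -/
def primeClasses (G : Graph V E) : Set (Cycle E) :=
  {c | ∃ γ : List E, (γ : Cycle E) = c ∧ IsBTCycle G γ ∧ IsPrimitive G γ}

/-- The monomial of a cycle: the product of the indeterminates of its edges. -/
def cycleMonomial (c : Cycle E) : MvPowerSeries E ℤ :=
  (c.toMultiset.map fun e => (MvPowerSeries.X e : MvPowerSeries E ℤ)).prod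

/-- The factor `(1 - g(Γ))⁻¹` of the edge zeta function, as a formal power series. -/
def zetaFactor (G : Graph V E) (c : primeClasses G) : MvPowerSeries E ℤ :=
  MvPowerSeries.invOfUnit (1 - cycleMonomial c.1) 1

/-- The edge zeta function: the product is taken in the ring of formal power series, for the
topology of coefficientwise convergence. -/
def edgeZeta (G : Graph V E) : MvPowerSeries E ℤ := ∏' c : primeClasses G, zetaFactor G c

/-- The Newton polyhedron of a power series: the convex hull of the exponent vectors of its
terms with nonzero coefficient. -/
def newtonPolyhedron (f : MvPowerSeries E ℤ) : Set (E → ℝ) :=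
  convexHull ℝ {x | ∃ m : E →₀ ℕ, MvPowerSeries.coeff m f ≠ 0 ∧ x = fun e => (m e : ℝ)}

/-- The set `S` of edges is nonempty and connected: from each edge of `S` one can get to each other
one through edges of `S`, where successive edges share an end. -/
def IsConnectedEdgeSet (G : Graph V E) (S : Set E) : Prop :=
  S.Nonempty ∧ ∀ e ∈ S, ∀ f ∈ S,
    Relation.ReflTransGen (fun a b => b ∈ S ∧ ∃ v, G.Inc a v ∧ G.Inc b v) e f

end Zeta

end

end CycleCode

/-! Call a multiset of edges balanced if at every vertex its edge ends can be partitioned into pairs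
of distinct edges; this is possible if and only if the number of ends is even and no edge
contributes more than half of them. Following the pairs splits a balanced multiset into
backtrackless tailless cycles. Two such cycles with a common vertex can be spliced, after reversing
one of them if necessary, and so a connected balanced multiset consists of the edges of a single
cycle.

At each check node of a cover, a codeword selects an even number of distinct bits, so the edge
multiset of an unscaled pseudo-codeword is balanced. Conversely, the pairs at a check can be
distributed over the copies of that check in a lift of the Tanner graph, whose permutations are then
chosen to connect the right copies.

Each factor of the zeta function is a geometric series with nonnegative coefficients. Hence nothing
cancels, and the exponents of the zeta function form the monoid generated by the primitive cycles,
which is the monoid of balanced multisets. An integer vector in the fundamental cone is balanced as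
soon as its coordinates are even, so the convex hull of the exponents contains the rational points
of the cone. These generate the cone because the inequalities that define it have rational
coefficients. -/

namespace CycleCode

section DistinctPairs

variable {E : Type*} {s : Multiset E} {e : E}

/-- The multisets that can be partitioned into pairs of distinct elements. -/
def distinctPairs (E : Type*) : AddSubmonoid (Multiset E) :=
  AddSubmonoid.closure {s | ∃ a b, a ≠ b ∧ s = {a, b}}

theorem cons_cons_mem_distinctPairs {a b : E} (hab : a ≠ b) (hs : s ∈ distinctPairs E) :
    a ::ₘ b ::ₘ s ∈ distinctPairs E := by
  have hpair : {a, b} ∈ distinctPairs E := AddSubmonoid.subset_closure ⟨a, b, hab, rfl⟩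
  simpa using add_mem hpair hs

@[elab_as_elim]
theorem distinctPairs_induction {motive : (s : Multiset E) → s ∈ distinctPairs E → Prop}
    (zero : motive 0 (zero_mem _))
    (cons_cons : ∀ a b s hs (hab : a ≠ b), motive s hs →
      motive (a ::ₘ b ::ₘ s) (cons_cons_mem_distinctPairs hab hs))
    (hs : s ∈ distinctPairs E) : motive s hs := by
  induction hs using AddSubmonoid.closure_induction_left with
  | zero => exact zero
  | add_left x hx y hy ih =>
    obtain ⟨a, b, hab, rfl⟩ := hx
    simpa using cons_cons a b y hy hab ih

theorem exists_cons_cons_of_mem_distinctPairs (hs : s ∈ distinctPairs E) (he : e ∈ s) :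
    ∃ f ≠ e, ∃ t ∈ distinctPairs E, s = e ::ₘ f ::ₘ t := by
  induction hs using distinctPairs_induction with
  | zero => simp at he
  | cons_cons a b s hs hab ih =>
    rcases eq_or_ne e a with rfl | hea
    · exact ⟨b, hab.symm, s, hs, rfl⟩
    rcases eq_or_ne e b with rfl | heb
    · exact ⟨a, hab, s, hs, Multiset.cons_swap ..⟩
    obtain ⟨f, hfe, t, ht, rfl⟩ := ih (by simpa [hea, heb] using he)
    refine ⟨f, hfe, a ::ₘ b ::ₘ t, cons_cons_mem_distinctPairs hab ht, ?_⟩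
    simp only [← Multiset.singleton_add]
    abel

theorem even_card_of_mem_distinctPairs (hs : s ∈ distinctPairs E) : Even s.card := by
  induction hs using distinctPairs_induction with
  | zero => simp
  | cons_cons a b s hs hab ih => simpa [add_assoc] using ih.add even_two

theorem two_mul_count_le_card_of_mem_distinctPairs [DecidableEq E] (hs : s ∈ distinctPairs E)
    (e : E) : 2 * s.count e ≤ s.card := by
  induction hs using distinctPairs_induction with
  | zero => simp
  | cons_cons a b s hs hab ih =>
    simp only [Multiset.count_cons, Multiset.card_cons]
    grind

theorem count_add_count_le_card [DecidableEq E] {a b : E} (s : Multiset E) (hab : a ≠ b) :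
    s.count a + s.count b ≤ s.card := by
  induction s using Multiset.induction_on with
  | empty => simp
  | cons c s ih =>
    simp only [Multiset.count_cons, Multiset.card_cons]
    grind

theorem mem_distinctPairs_iff [DecidableEq E] :
    s ∈ distinctPairs E ↔ Even s.card ∧ ∀ e, 2 * s.count e ≤ s.card := by
  refine ⟨fun hs => ⟨even_card_of_mem_distinctPairs hs,
    two_mul_count_le_card_of_mem_distinctPairs hs⟩, ?_⟩
  rintro ⟨heven, hle⟩
  induction hn : s.card using Nat.strong_induction_on generalizing s with
  | _ n ih =>
  rcases s.empty_or_exists_mem with rfl | ⟨c, hc⟩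
  · exact zero_mem _
  -- Pairing a most frequent element with any other one preserves the condition.
  obtain ⟨a, has, hmax⟩ := s.toFinset.exists_max_image s.count ⟨c, Multiset.mem_toFinset.2 hc⟩
  obtain ⟨s, rfl⟩ := Multiset.exists_cons_of_mem (Multiset.mem_toFinset.1 has)
  obtain ⟨b, hbs, hba⟩ : ∃ b ∈ s, b ≠ a := by
    by_contra! hall
    have := hle a
    rw [Multiset.eq_replicate_card.2 hall] at this
    simp at this
  obtain ⟨t, rfl⟩ := Multiset.exists_cons_of_mem hbs
  have hmax (e : E) : (a ::ₘ b ::ₘ t).count e ≤ (a ::ₘ b ::ₘ t).count a := by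
    by_cases he : e ∈ a ::ₘ b ::ₘ t
    · exact hmax e (Multiset.mem_toFinset.2 he)
    · simp [Multiset.count_eq_zero_of_notMem he]
  refine cons_cons_mem_distinctPairs hba.symm (ih t.card (by simp [← hn]) ?_ (fun e => ?_) rfl)
  · simpa [add_assoc, Nat.even_add] using heven
  · have hmaxe := hmax e
    have hlee := hle e
    have hlea := hle a
    simp only [Multiset.count_cons, Multiset.card_cons, hba.symm, ↓reduceIte] at hmaxe hlee hlea
    by_cases hea : e = a
    · grind
    · have := count_add_count_le_card t hea
      simp only [Multiset.card_cons] at heven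
      clear ih hle hmax
      grind

theorem mem_distinctPairs_of_nodup (hs : s.Nodup) (heven : Even s.card) : s ∈ distinctPairs E := by
  classical
  refine mem_distinctPairs_iff.2 ⟨heven, fun e => ?_⟩
  have := Multiset.nodup_iff_count_le_one.1 hs e
  have := s.count_le_card e
  grind

theorem exists_even_finsets_sum_eq (hs : s ∈ distinctPairs E) {M : ℕ} (hM : s.card ≤ M) :
    ∃ T : Fin M → Finset E, (∀ t, Even (T t).card) ∧ ∑ t, (T t).val = s := by
  induction hs using distinctPairs_induction generalizing M with
  | zero => exact ⟨fun _ => ∅, by simp, by simp⟩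
  | cons_cons a b s _ hab ih =>
    obtain _ | M := M
    · simp at hM
    rw [Multiset.card_cons, Multiset.card_cons] at hM
    obtain ⟨T, heven, hsum⟩ := ih (M := M) (by omega)
    classical
    refine ⟨Fin.cons {a, b} T, Fin.forall_fin_succ.2 ⟨?_, by simpa using heven⟩, ?_⟩
    · simp [Finset.card_pair hab]
    · simp [Fin.sum_univ_succ, hsum, hab]

end DistinctPairs

section Walks

variable {V E : Type*} {G : Graph V E} {u v : V} {e : E} {l : List E}

/-- `IsWalk G u l v` says that the edges of `l`, suitably directed, lead from `u` to `v` in `G`. -/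
def IsWalk (G : Graph V E) : V → List E → V → Prop
  | u, [], v => u = v
  | u, e :: l, v => ∃ x, G.IsLink e u x ∧ IsWalk G x l v

theorem isWalk_append {l' : List E} :
    IsWalk G u (l ++ l') v ↔ ∃ x, IsWalk G u l x ∧ IsWalk G x l' v := by
  induction l generalizing u with
  | nil => simp [IsWalk]
  | cons e l ih => simp only [List.cons_append, IsWalk, ih]; tauto

theorem isWalk_singleton : IsWalk G u [e] v ↔ G.IsLink e u v := by
  simp [IsWalk]

theorem IsWalk.reverse (h : IsWalk G u l v) : IsWalk G v l.reverse u := by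
  induction l generalizing u with
  | nil => exact Eq.symm h
  | cons e l ih =>
    obtain ⟨x, hx, h⟩ := h
    exact List.reverse_cons ▸ isWalk_append.2 ⟨x, ih h, isWalk_singleton.2 hx.symm⟩

theorem IsWalk.edge_mem (h : IsWalk G u l v) (he : e ∈ l) : e ∈ G.edgeSet := by
  induction l generalizing u with
  | nil => simp at he
  | cons e' l ih =>
    obtain ⟨x, hx, h⟩ := h
    rcases List.mem_cons.1 he with rfl | he
    exacts [hx.edge_mem, ih h he]

theorem isWalk_iff_exists : IsWalk G u l v ↔ ∃ w : Fin (l.length + 1) → V,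
    w 0 = u ∧ w (Fin.last _) = v ∧
      ∀ s : Fin l.length, G.IsLink (l.get s) (w s.castSucc) (w s.succ) := by
  induction l generalizing u with
  | nil => exact ⟨fun h => ⟨fun _ => u, rfl, h, fun s => s.elim0⟩, fun ⟨_, h0, h1, _⟩ => h0 ▸ h1⟩
  | cons e l ih =>
    simp only [List.length_cons]
    constructor
    · rintro ⟨x, hx, h⟩
      obtain ⟨w, h0, h1, hw⟩ := ih.1 h
      refine ⟨Fin.cons u w, rfl, by simpa [← Fin.succ_last] using h1, Fin.cases ?_ fun t => ?_⟩
      · simpa [h0] using hx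
      · simpa using hw t
    · rintro ⟨w, h0, h1, hw⟩
      refine ⟨w 1, ?_, ih.2 ⟨Fin.tail w, rfl, h1, fun s => hw s.succ⟩⟩
      simpa [h0] using hw 0

theorem isCycle_iff : IsCycle G l ↔ l ≠ [] ∧ ∃ u, IsWalk G u l u := by
  simp only [IsCycle, isWalk_iff_exists]
  exact and_congr_right fun _ =>
    ⟨fun ⟨w, h, hw⟩ => ⟨w 0, w, rfl, h, hw⟩, fun ⟨_, w, h0, h, hw⟩ => ⟨w, h.trans h0.symm, hw⟩⟩

theorem isBTCycle_iff : IsBTCycle G l ↔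
    (∃ u, IsWalk G u l u) ∧ l.IsChain (· ≠ ·) ∧ l.head? ≠ l.getLast? := by
  refine (and_congr_left fun h => isCycle_iff.trans (and_iff_right ?_)).trans Iff.rfl
  rintro rfl
  exact h.2 rfl

theorem isBTCycle_iff_chain : IsBTCycle G l ↔
    l ≠ [] ∧ (∃ u, IsWalk G u l u) ∧ (l : Cycle E).Chain (· ≠ ·) := by
  rw [isBTCycle_iff]
  cases l with
  | nil => simp
  | cons e l =>
    have hlast := List.getLast?_eq_some_getLast (List.cons_ne_nil e l)
    simp only [Cycle.chain_coe_cons, ← List.cons_append, List.isChain_append, hlast]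
    simp [eq_comm]

theorem IsBTCycle.ne_nil (h : IsBTCycle G l) : l ≠ [] := h.1.1

theorem IsBTCycle.edge_mem (h : IsBTCycle G l) (he : e ∈ l) : e ∈ G.edgeSet :=
  (isBTCycle_iff.1 h).1.elim fun _ hu => hu.edge_mem he

end Walks

section EdgeEnds

variable {V E : Type*} {G : Graph V E} {u v : V} {e e₀ : E} {l : List E} {s : Multiset E}

open scoped Classical in
/-- The edges of the multiset `s` that end at the vertex `v`, as a function of `v`. Loops at `v`
are listed twice, since both of their ends are `v`. -/
noncomputable def edgeEnds (G : Graph V E) : Multiset E →+ (V → Multiset E) where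
  toFun s v := s.filter (G.Inc · v) + s.filter (G.IsLoopAt · v)
  map_zero' := by ext; simp
  map_add' s t := by
    funext v
    simp only [Multiset.filter_add, Pi.add_apply]
    abel

theorem mem_edgeEnds : e ∈ edgeEnds G s v ↔ e ∈ s ∧ G.Inc e v := by
  simp only [edgeEnds, AddMonoidHom.coe_mk, ZeroHom.coe_mk, Multiset.mem_add, Multiset.mem_filter]
  exact ⟨fun h => h.elim id fun h => ⟨h.1, h.2.inc⟩, Or.inl⟩

theorem edgeEnds_singleton [DecidableEq V] (h : G.IsLink e u v) :
    edgeEnds G {e} = Pi.single u {e} + Pi.single v {e} := by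
  funext w
  have hinc : G.Inc e w ↔ w = u ∨ w = v :=
    ⟨fun h' => h'.eq_or_eq_of_isLink h, by rintro (rfl | rfl); exacts [h.inc_left, h.inc_right]⟩
  have hloop : G.IsLoopAt e w ↔ w = u ∧ w = v := by
    refine ⟨fun h' => ⟨h'.eq_of_inc h.inc_left, h'.eq_of_inc h.inc_right⟩, ?_⟩
    rintro ⟨rfl, rfl⟩
    exact h
  simp only [edgeEnds, AddMonoidHom.coe_mk, ZeroHom.coe_mk, Multiset.filter_singleton, hinc, hloop,
    Pi.add_apply, Pi.single_apply]
  by_cases hu : w = u <;> by_cases hv : w = v <;>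
    simp [hu, hv, -Multiset.singleton_add, add_comm]

theorem edgeEnds_cons [DecidableEq V] (h : G.IsLink e u v) (s : Multiset E) :
    edgeEnds G (e ::ₘ s) = edgeEnds G s + Pi.single u {e} + Pi.single v {e} := by
  rw [← Multiset.singleton_add, map_add, edgeEnds_singleton h]
  abel

/-- The families of multisets of edges, one for each vertex, all of which can be partitioned into
pairs of distinct edges. -/
def vertexPairs (V E : Type*) : AddSubmonoid (V → Multiset E) :=
  AddSubmonoid.pi Set.univ fun _ => distinctPairs E

/-- The multisets of edges of `G` whose ends can be partitioned, at every vertex, into pairs of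
distinct edges. -/
def balanced (G : Graph V E) : AddSubmonoid (Multiset E) where
  carrier := {s | (∀ e ∈ s, e ∈ G.edgeSet) ∧ edgeEnds G s ∈ vertexPairs V E}
  zero_mem' := by simp
  add_mem' hs ht := ⟨fun _ he => (Multiset.mem_add.1 he).elim (hs.1 _) (ht.1 _),
    by simpa only [map_add] using add_mem hs.2 ht.2⟩

theorem single_add_single_mem_vertexPairs [DecidableEq V] (v : V) (h : e₀ ≠ e) :
    Pi.single v {e₀} + Pi.single v {e} ∈ vertexPairs V E := by
  intro x _
  rw [← Pi.single_add]
  rcases eq_or_ne x v with rfl | hx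
  · simpa using cons_cons_mem_distinctPairs h (zero_mem _)
  · simp [hx]

theorem exists_eq_add_single_of_mem_vertexPairs [DecidableEq V] {x : V → Multiset E}
    (h : x + Pi.single v {e} ∈ vertexPairs V E) :
    ∃ f ≠ e, ∃ y ∈ vertexPairs V E, x = y + Pi.single v {f} := by
  obtain ⟨f, hfe, t, ht, hxt⟩ := exists_cons_cons_of_mem_distinctPairs (h v trivial)
    (e := e) (by simp)
  have hxv : x v = f ::ₘ t := by
    refine Multiset.cons_inj_right e |>.1 (Eq.trans ?_ hxt)
    simp [← Multiset.singleton_add, add_comm]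
  refine ⟨f, hfe, Function.update x v t, fun w hw => ?_, ?_⟩
  · rcases eq_or_ne w v with rfl | hwv
    · simpa using ht
    · simpa [hwv] using h w hw
  · funext w
    rcases eq_or_ne w v with rfl | hwv
    · simp [hxv, ← Multiset.singleton_add, add_comm]
    · simp [hwv]

theorem IsWalk.exists_edgeEnds_eq [DecidableEq V] (h : IsWalk G u l v) (hc : l.IsChain (· ≠ ·))
    (hhead : l.head? = some e₀) (hlast : l.getLast? = some e) :
    ∃ t ∈ vertexPairs V E, edgeEnds G l = t + Pi.single u {e₀} + Pi.single v {e} := by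
  induction l generalizing u e₀ with
  | nil => simp at hhead
  | cons e₁ l ih =>
    obtain rfl : e₁ = e₀ := by simpa using hhead
    obtain ⟨x, hx, h⟩ := h
    cases l with
    | nil =>
      obtain rfl : e₁ = e := by simpa using hlast
      obtain rfl : x = v := h
      exact ⟨0, zero_mem _, by simpa using edgeEnds_singleton hx⟩
    | cons e₂ l =>
      obtain ⟨hne, hc⟩ := List.isChain_cons_cons.1 hc
      obtain ⟨t, ht, hl⟩ := ih h hc rfl (by simpa using hlast)
      refine ⟨t + (Pi.single x {e₁} + Pi.single x {e₂}),
        add_mem ht (single_add_single_mem_vertexPairs x hne), ?_⟩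
      rw [← Multiset.cons_coe, edgeEnds_cons hx, hl]
      abel

theorem IsBTCycle.mem_balanced (h : IsBTCycle G l) : ↑l ∈ balanced G := by
  classical
  obtain ⟨⟨u, hu⟩, hc, ht⟩ := isBTCycle_iff.1 h
  have hhead := List.head?_eq_some_head h.ne_nil
  have hlast := List.getLast?_eq_some_getLast h.ne_nil
  obtain ⟨t, htP, hl⟩ := hu.exists_edgeEnds_eq hc hhead hlast
  rw [hhead, hlast, Ne, Option.some_inj] at ht
  refine ⟨fun e he => h.edge_mem he, ?_⟩
  rw [hl, add_assoc]
  exact add_mem htP (single_add_single_mem_vertexPairs u ht)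

/-- Following the pairing of the edge ends extends the walk until it closes up. -/
theorem IsWalk.exists_isBTCycle [DecidableEq V] {q : Multiset E} (h : IsWalk G u l v)
    (hc : l.IsChain (· ≠ ·)) (hhead : l.head? = some e₀) (hlast : l.getLast? = some e)
    (hq : edgeEnds G q + Pi.single u {e₀} + Pi.single v {e} ∈ vertexPairs V E) :
    ∃ γ q', IsBTCycle G γ ∧ e₀ ∈ γ ∧ edgeEnds G q' ∈ vertexPairs V E ∧ ↑γ + q' = ↑l + q := by
  induction q using Multiset.strongInductionOn generalizing l v e with
  | ih q ih =>
  obtain ⟨f, hfe, y, hy, hqy⟩ := exists_eq_add_single_of_mem_vertexPairs hq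
  have hf : f ∈ edgeEnds G q v ∨ f ∈ (Pi.single u {e₀} : V → Multiset E) v := by
    rw [← Multiset.mem_add, ← Pi.add_apply, hqy]
    simp
  rcases hf with hf | hf
  · obtain ⟨hfq, w, hfw⟩ := mem_edgeEnds.1 hf
    obtain ⟨q, rfl⟩ := Multiset.exists_cons_of_mem hfq
    rw [edgeEnds_cons hfw.symm, add_right_comm, add_left_inj, add_right_comm] at hqy
    have hchain : (l ++ [f]).IsChain (· ≠ ·) :=
      List.isChain_append.2 ⟨hc, List.isChain_singleton f, by simp [hlast, hfe.symm]⟩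
    obtain ⟨γ, q', hγ, he₀, hq', hγq⟩ := ih q (Multiset.lt_cons_self q f)
      (isWalk_append.2 ⟨v, h, isWalk_singleton.2 hfw⟩) hchain (by simp [hhead]) (by simp)
      (hqy ▸ hy)
    refine ⟨γ, q', hγ, he₀, hq', hγq.trans ?_⟩
    rw [← Multiset.coe_add, add_assoc, Multiset.coe_singleton, Multiset.singleton_add]
  · obtain rfl : v = u := by
      by_contra hvu
      simp [hvu] at hf
    obtain rfl : f = e₀ := by simpa using hf
    rw [add_left_inj] at hqy
    refine ⟨l, q, isBTCycle_iff.2 ⟨⟨v, h⟩, hc, ?_⟩, List.mem_of_mem_head? hhead, hqy ▸ hy, rfl⟩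
    rwa [hhead, hlast, Ne, Option.some_inj]

theorem exists_isBTCycle_add_eq_of_mem_balanced (hs : s ∈ balanced G) (he : e ∈ s) :
    ∃ γ, IsBTCycle G γ ∧ e ∈ γ ∧ ∃ t ∈ balanced G, s = γ + t := by
  classical
  obtain ⟨q, rfl⟩ := Multiset.exists_cons_of_mem he
  obtain ⟨u, v, huv⟩ := Graph.exists_isLink_of_mem_edgeSet (hs.1 e he)
  obtain ⟨γ, t, hγ, heγ, ht, hγt⟩ := IsWalk.exists_isBTCycle (isWalk_singleton.2 huv)
    (List.isChain_singleton e) rfl rfl (edgeEnds_cons huv q ▸ hs.2)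
  rw [Multiset.coe_singleton, Multiset.singleton_add] at hγt
  refine ⟨γ, hγ, heγ, t, ⟨fun f hf => hs.1 f ?_, ht⟩, hγt.symm⟩
  exact hγt ▸ Multiset.mem_add.2 (Or.inr hf)

theorem closure_isBTCycle_eq_balanced (G : Graph V E) :
    AddSubmonoid.closure {s | ∃ γ, IsBTCycle G γ ∧ ↑γ = s} = balanced G := by
  refine le_antisymm (AddSubmonoid.closure_le.2 ?_) fun s hs => ?_
  · rintro _ ⟨γ, hγ, rfl⟩
    exact hγ.mem_balanced
  induction s using Multiset.strongInductionOn with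
  | ih s ih =>
  rcases s.empty_or_exists_mem with rfl | ⟨e, he⟩
  · exact zero_mem _
  obtain ⟨γ, hγ, -, t, ht, rfl⟩ := exists_isBTCycle_add_eq_of_mem_balanced hs he
  have hlt : t < γ + t := lt_add_of_pos_left t (by simpa [pos_iff_ne_zero] using hγ.ne_nil)
  exact add_mem (AddSubmonoid.subset_closure ⟨γ, hγ, rfl⟩) (ih t hlt ht)

end EdgeEnds

section Merge

variable {V E : Type*} {G : Graph V E} {u v : V} {e e' : E} {a b l : List E} {A B S : Set E}

theorem IsBTCycle.append_comm (h : IsBTCycle G (a ++ b)) (hv : IsWalk G v (b ++ a) v) :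
    IsBTCycle G (b ++ a) := by
  obtain ⟨hne, -, hc⟩ := isBTCycle_iff_chain.1 h
  refine isBTCycle_iff_chain.2 ⟨by simpa [and_comm] using hne, ⟨v, hv⟩, ?_⟩
  rwa [Cycle.coe_eq_coe.2 List.isRotated_append] at hc

theorem IsBTCycle.exists_perm_isWalk (h : IsBTCycle G l) (he : e ∈ l) (hv : G.Inc e v) :
    ∃ l', IsBTCycle G l' ∧ IsWalk G v l' v ∧ l'.Perm l := by
  obtain ⟨⟨u, hu⟩, -⟩ := isBTCycle_iff.1 h
  obtain ⟨a, b, rfl, hua, hbu⟩ : ∃ a b, l = a ++ b ∧ IsWalk G u a v ∧ IsWalk G v b u := by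
    obtain ⟨a, b, rfl⟩ := List.append_of_mem he
    obtain ⟨x, hx, y, hxy, hy⟩ := isWalk_append.1 hu
    rcases hv.eq_or_eq_of_isLink hxy with rfl | rfl
    · exact ⟨a, e :: b, rfl, hx, y, hxy, hy⟩
    · exact ⟨a ++ [e], b, by simp, isWalk_append.2 ⟨x, hx, isWalk_singleton.2 hxy⟩, hy⟩
  have hba : IsWalk G v (b ++ a) v := isWalk_append.2 ⟨u, hbu, hua⟩
  exact ⟨b ++ a, h.append_comm hba, hba, List.perm_append_comm⟩

theorem IsBTCycle.reverse (h : IsBTCycle G l) : IsBTCycle G l.reverse := by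
  obtain ⟨⟨u, hu⟩, hc, hl⟩ := isBTCycle_iff.1 h
  refine isBTCycle_iff.2 ⟨⟨u, hu.reverse⟩, ?_, ?_⟩
  · exact List.isChain_reverse.2 (hc.imp fun _ _ h => h.symm)
  · simpa using hl.symm

theorem IsBTCycle.append (ha : IsBTCycle G a) (hb : IsBTCycle G b) (hva : IsWalk G v a v)
    (hvb : IsWalk G v b v) (hab : a.getLast? ≠ b.head?) (hba : b.getLast? ≠ a.head?) :
    IsBTCycle G (a ++ b) := by
  refine isBTCycle_iff.2 ⟨⟨v, isWalk_append.2 ⟨v, hva, hvb⟩⟩,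
    List.isChain_append.2 ⟨ha.2.1, hb.2.1, fun x hx y hy hxy => hab ?_⟩, ?_⟩
  · rw [hx, hy, hxy]
  · rw [List.head?_append_of_ne_nil _ ha.ne_nil, List.getLast?_append_of_ne_nil _ hb.ne_nil]
    exact hba.symm

theorem IsBTCycle.exists_perm_append (ha : IsBTCycle G a) (hb : IsBTCycle G b) (hea : e ∈ a)
    (heb : e' ∈ b) (hev : G.Inc e v) (hev' : G.Inc e' v) :
    ∃ l, IsBTCycle G l ∧ l.Perm (a ++ b) := by
  obtain ⟨a', ha', hva, hperma⟩ := ha.exists_perm_isWalk hea hev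
  obtain ⟨b', hb', hvb, hpermb⟩ := hb.exists_perm_isWalk heb hev'
  -- If traversing `b'` forwards creates a backtrack or a tail, traversing it backwards does not.
  by_cases hab : a'.getLast? ≠ b'.head? ∧ b'.getLast? ≠ a'.head?
  · exact ⟨a' ++ b', ha'.append hb' hva hvb hab.1 hab.2, hperma.append hpermb⟩
  · have hta : a'.head? ≠ a'.getLast? := ha'.2.2
    have htb : b'.head? ≠ b'.getLast? := hb'.2.2
    refine ⟨a' ++ b'.reverse, ha'.append hb'.reverse hva hvb.reverse ?_ ?_,
      hperma.append ((List.reverse_perm b').trans hpermb)⟩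
    · grind
    · grind

theorem IsWalk.reflTransGen (h : IsWalk G u l v) (hl : ∀ f ∈ l, f ∈ S) (he : G.Inc e u) :
    ∀ f ∈ l, Relation.ReflTransGen (fun a b => b ∈ S ∧ ∃ v, G.Inc a v ∧ G.Inc b v) e f := by
  induction l generalizing u e with
  | nil => simp
  | cons e' l ih =>
    obtain ⟨x, hx, h⟩ := h
    have hstep := Relation.ReflTransGen.single
      (r := fun a b => b ∈ S ∧ ∃ v, G.Inc a v ∧ G.Inc b v) ⟨hl e' (by simp), u, he, hx.inc_left⟩
    rintro f (_ | ⟨_, hf⟩)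
    · exact hstep
    · exact hstep.trans (ih h (fun f hf => hl f (.tail _ hf)) hx.inc_right f hf)

theorem IsBTCycle.isConnectedEdgeSet (h : IsBTCycle G l) : IsConnectedEdgeSet G {e | e ∈ l} := by
  refine ⟨List.exists_mem_of_ne_nil l h.ne_nil, fun e he f hf => ?_⟩
  obtain ⟨v, w, hvw⟩ := Graph.exists_isLink_of_mem_edgeSet (h.edge_mem he)
  obtain ⟨l', -, hl', hperm⟩ := h.exists_perm_isWalk he hvw.inc_left
  exact hl'.reflTransGen (fun f hf => hperm.mem_iff.1 hf) hvw.inc_left f (hperm.mem_iff.2 hf)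

theorem IsConnectedEdgeSet.exists_inc_inc (h : IsConnectedEdgeSet G (A ∪ B)) (hA : A.Nonempty)
    (hB : B.Nonempty) (hAE : A ⊆ G.edgeSet) : ∃ a ∈ A, ∃ b ∈ B, ∃ v, G.Inc a v ∧ G.Inc b v := by
  by_contra! hdisj
  obtain ⟨a, ha⟩ := hA
  obtain ⟨b, hb⟩ := hB
  have hreach := h.2 a (.inl ha) b (.inr hb)
  have hbA : b ∈ A := by
    clear hb
    induction hreach with
    | refl => exact ha
    | tail _ hstep ih =>
      obtain ⟨hAB, v, hcv, hdv⟩ := hstep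
      exact hAB.resolve_right fun hdB => hdisj _ ih _ hdB v hcv hdv
  obtain ⟨v, w, hvw⟩ := Graph.exists_isLink_of_mem_edgeSet (hAE hbA)
  exact hdisj b hbA b hb v hvw.inc_left hvw.inc_left

theorem IsBTCycle.exists_coe_eq_add (h : IsBTCycle G l) {t : Multiset E} (ht : t ∈ balanced G)
    (hc : IsConnectedEdgeSet G {e | e ∈ ↑l + t}) : ∃ l', IsBTCycle G l' ∧ ↑l' = ↑l + t := by
  induction t using Multiset.strongInductionOn generalizing l with
  | ih t ih =>
  rcases t.empty_or_exists_mem with rfl | ⟨f, hf⟩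
  · exact ⟨l, h, by simp⟩
  have hunion : {e | e ∈ ↑l + t} = {e | e ∈ l} ∪ {e | e ∈ t} := by
    ext
    simp
  obtain ⟨a, ha, b, hb, v, hav, hbv⟩ := (hunion ▸ hc).exists_inc_inc
    (List.exists_mem_of_ne_nil l h.ne_nil) ⟨f, hf⟩ fun e he => h.edge_mem he
  obtain ⟨γ, hγ, hbγ, t', ht', rfl⟩ := exists_isBTCycle_add_eq_of_mem_balanced ht hb
  obtain ⟨l', hl', hperm⟩ := h.exists_perm_append hγ ha hbγ hav hbv
  have hsum : (l : Multiset E) + (γ + t') = l' + t' := by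
    rw [Multiset.coe_eq_coe.2 hperm, ← Multiset.coe_add, add_assoc]
  have hlt : t' < γ + t' := lt_add_of_pos_left t' (by simpa [pos_iff_ne_zero] using hγ.ne_nil)
  rw [hsum] at hc ⊢
  exact ih t' hlt hl' ht' hc

theorem exists_isBTCycle_coe_eq_iff {s : Multiset E} : (∃ l, IsBTCycle G l ∧ ↑l = s) ↔
    s ∈ balanced G ∧ IsConnectedEdgeSet G {e | e ∈ s} := by
  constructor
  · rintro ⟨l, hl, rfl⟩
    exact ⟨hl.mem_balanced, hl.isConnectedEdgeSet⟩
  · rintro ⟨hs, hc⟩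
    obtain ⟨e, he⟩ := hc.1
    obtain ⟨γ, hγ, -, t, ht, rfl⟩ := exists_isBTCycle_add_eq_of_mem_balanced hs he
    exact hγ.exists_coe_eq_add ht hc

end Merge

section NormalGraph

variable {J I : Type*} {H : Matrix J I (ZMod 2)} {i : I} {j : J}

theorem exists_isLink_normalGraph (hH : IsCycleCode H) (i : I) :
    ∃ a b, (normalGraph H).IsLink i a b :=
  (Set.ncard_eq_two.1 (hH i)).imp fun _ h => h

theorem normalGraph_inc_iff (hH : IsCycleCode H) : (normalGraph H).Inc i j ↔ H j i = 1 := by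
  constructor
  · rintro ⟨b, -, hi⟩
    exact hi.symm.subset (Set.mem_insert j {b})
  · intro h
    obtain ⟨a, b, hab⟩ := exists_isLink_normalGraph hH i
    obtain rfl | rfl : j ∈ ({a, b} : Set J) := hab.2.subset h
    exacts [hab.inc_left, hab.inc_right]

theorem mem_edgeSet_normalGraph (hH : IsCycleCode H) (i : I) : i ∈ (normalGraph H).edgeSet :=
  let ⟨_, _, h⟩ := exists_isLink_normalGraph hH i
  h.edge_mem

theorem edgeEnds_normalGraph (hH : IsCycleCode H) (s : Multiset I) (j : J) :
    edgeEnds (normalGraph H) s j = s.filter (H j · = 1) := by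
  classical
  have hloop : ∀ i ∈ s, ¬ (normalGraph H).IsLoopAt i j := fun i _ h => h.1 rfl
  simp only [edgeEnds, AddMonoidHom.coe_mk, ZeroHom.coe_mk, normalGraph_inc_iff hH]
  rw [Multiset.filter_eq_nil.2 hloop, add_zero]

theorem mem_balanced_normalGraph_iff (hH : IsCycleCode H) {s : Multiset I} :
    s ∈ balanced (normalGraph H) ↔ ∀ j, s.filter (H j · = 1) ∈ distinctPairs I := by
  change (∀ i ∈ s, _) ∧ edgeEnds _ s ∈ vertexPairs J I ↔ _
  simp [mem_edgeSet_normalGraph hH, vertexPairs, AddSubmonoid.mem_pi, edgeEnds_normalGraph hH]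

end NormalGraph

section PseudoCodewords

variable {J I W : Type*} {H : Matrix J I (ZMod 2)} {Y : SimpleGraph W}
  {π : Y →g tannerGraph H} {c : BitNode π → ZMod 2}

theorem isCover_iff {V : Type*} {X : SimpleGraph V} {π : Y →g X} : IsCover π ↔
    Function.Surjective π ∧ ∀ y x, X.Adj (π y) x → ∃! z, Y.Adj y z ∧ π z = x := by
  refine and_congr_right fun _ => forall_congr' fun y => ⟨fun h x hx => ?_, fun h => ?_⟩
  · obtain ⟨z, hz, hzx⟩ := h.surjOn hx
    exact ⟨z, ⟨hz, hzx⟩, fun z' hz' => h.injOn hz'.1 hz (hz'.2.trans hzx.symm)⟩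
  · exact ⟨fun _ => π.map_adj, fun z hz z' hz' heq =>
      (h _ (π.map_adj hz)).unique ⟨hz, rfl⟩ ⟨hz', heq.symm⟩, fun x hx => (h x hx).exists⟩

/-- The bit of which the bit node `x` of a cover is a copy. -/
noncomputable def BitNode.bit (x : BitNode π) : I := x.2.choose

theorem BitNode.map_eq_inl_bit (x : BitNode π) : π x.1 = .inl x.bit := x.2.choose_spec

theorem BitNode.bit_eq_iff {x : BitNode π} {i : I} : x.bit = i ↔ π x.1 = .inl i := by
  rw [x.map_eq_inl_bit, Sum.inl.injEq]

variable [Fintype W]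

open scoped Classical in
theorem isCoverCodeword_iff_of_bijective {K : Type*} [Fintype K] {b : K → BitNode π}
    (hb : b.Bijective) : IsCoverCodeword π c ↔
      ∀ w j, π w = .inr j → ∑ k, (if Y.Adj w (b k).1 then c (b k) else 0) = 0 := by
  simp only [IsCoverCodeword, Finset.sum_filter, ← hb.sum_comp]

open scoped Classical in
theorem unscaledPseudoCodeword_eq_of_bijective {K : Type*} [Fintype K] {b : K → BitNode π}
    (hb : b.Bijective) (i : I) : unscaledPseudoCodeword π c i =
      ∑ k, if π (b k).1 = .inl i then (c (b k)).val else 0 := by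
  simp only [unscaledPseudoCodeword, Finset.sum_filter, ← hb.sum_comp]

open scoped Classical in
/-- The bits, with multiplicity, to whose copies the word `c` on a cover assigns the value `1`. -/
noncomputable def bitMultiset (c : BitNode π → ZMod 2) : Multiset I :=
  (Finset.univ.filter (c · = 1)).val.map BitNode.bit

open scoped Classical in
theorem count_bitMultiset (i : I) :
    (bitMultiset c).count i = unscaledPseudoCodeword π c i := by
  have hval : ∀ a : ZMod 2, a.val = if a = 1 then 1 else 0 := by decide
  rw [bitMultiset, Multiset.count_map, ← Finset.filter_val, ← Finset.card_def,
    unscaledPseudoCodeword]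
  simp only [hval, ← Finset.card_filter, Finset.filter_filter, and_comm, eq_comm (a := i),
    BitNode.bit_eq_iff]

open scoped Classical in
theorem IsCoverCodeword.even_card (hc : IsCoverCodeword π c) {w : W} {j : J} (hw : π w = .inr j) :
    Even (Finset.univ.filter fun x : BitNode π => Y.Adj w x.1 ∧ c x = 1).card := by
  have hval : ∀ a : ZMod 2, a = if a = 1 then 1 else 0 := by decide
  rw [← ZMod.natCast_eq_zero_iff_even, ← hc w j hw, ← Finset.filter_filter, ← Finset.sum_boole]
  exact Finset.sum_congr rfl fun x _ => (hval (c x)).symm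

open scoped Classical in
theorem filter_bitMultiset (hπ : IsCover π) (j : J) : (bitMultiset c).filter (H j · = 1) =
    ∑ w : W with π w = .inr j,
      (Finset.univ.filter fun x : BitNode π => Y.Adj w x.1 ∧ c x = 1).val.map BitNode.bit := by
  have hunique : ∀ x : BitNode π, H j x.bit = 1 → ∃! w, Y.Adj x.1 w ∧ π w = .inr j :=
    fun x hx => (isCover_iff.1 hπ).2 _ _ (by rw [x.map_eq_inl_bit]; exact hx)
  have hadj : ∀ (x : BitNode π) w, Y.Adj w x.1 → π w = .inr j → H j x.bit = 1 := by
    intro x w hwx hw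
    have h := π.map_adj hwx
    rwa [hw, x.map_eq_inl_bit] at h
  rw [bitMultiset, Multiset.filter_map, ← Finset.filter_val]
  have hdisj : (Finset.univ.filter (π · = .inr j) : Set W).PairwiseDisjoint
      fun w => Finset.univ.filter fun x : BitNode π => Y.Adj w x.1 ∧ c x = 1 := by
    intro w hw w' hw' hne
    simp only [Finset.coe_filter, Finset.mem_univ, true_and, Set.mem_ofPred_eq] at hw hw'
    refine Finset.disjoint_left.2 fun x hx hx' => hne ?_
    simp only [Finset.mem_filter, Finset.mem_univ, true_and] at hx hx'
    exact (hunique x (hadj x w hx.1 hw)).unique ⟨hx.1.symm, hw⟩ ⟨hx'.1.symm, hw'⟩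
  have hunion : (Finset.univ.filter (c · = 1)).filter ((H j · = 1) ∘ BitNode.bit) =
      (Finset.univ.filter (π · = .inr j)).disjiUnion _ hdisj := by
    ext x
    simp only [Finset.mem_filter, Finset.mem_univ, true_and, Function.comp_apply,
      Finset.mem_disjiUnion]
    constructor
    · rintro ⟨hcx, hx⟩
      obtain ⟨w, ⟨hw, hwj⟩, -⟩ := hunique x hx
      exact ⟨w, hwj, hw.symm, hcx⟩
    · rintro ⟨w, hwj, hw, hcx⟩
      exact ⟨hcx, hadj x w hw hwj⟩
  rw [hunion, Finset.disjiUnion_val, Multiset.map_bind]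
  rfl

theorem bitMultiset_mem_balanced (hH : IsCycleCode H) (hπ : IsCover π)
    (hc : IsCoverCodeword π c) : bitMultiset c ∈ balanced (normalGraph H) := by
  classical
  refine (mem_balanced_normalGraph_iff hH).2 fun j => ?_
  rw [filter_bitMultiset hπ]
  refine sum_mem fun w hw => mem_distinctPairs_of_nodup ?_ ?_
  · refine Multiset.Nodup.map_on (fun x hx x' hx' hxx' => ?_) (Finset.nodup _)
    simp only [Finset.mem_val, Finset.mem_filter, Finset.mem_univ, true_and] at hx hx'
    exact Subtype.ext <| (hπ.2 w).injOn hx.1 hx'.1 <| by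
      rw [x.map_eq_inl_bit, x'.map_eq_inl_bit, hxx']
  · rw [Multiset.card_map]
    exact hc.even_card (Finset.mem_filter.1 hw).2

end PseudoCodewords

section Lifts

variable {J I : Type*} {H : Matrix J I (ZMod 2)}

open scoped Classical in
theorem IsMCover.isUnscaledPseudoCodeword {W : Type*} [Fintype W] {Y : SimpleGraph W} {M : ℕ}
    {π : Y →g tannerGraph H} {c : BitNode π → ZMod 2} (hM : 0 < M) (hπ : IsMCover M π)
    (hc : IsCoverCodeword π c) : IsUnscaledPseudoCodeword H (unscaledPseudoCodeword π c) := by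
  let e : Fin (Fintype.card W) ≃ W := (Fintype.equivFin W).symm
  let φ : Y.comap e ≃g Y := SimpleGraph.Iso.comap e Y
  let b : BitNode π ≃ BitNode (π.comp φ.toHom) := e.symm.subtypeEquiv fun w => by simp [φ]
  have heb : ∀ x, e (b x).1 = x.1 := fun x => e.apply_symm_apply x.1
  let c' : BitNode (π.comp φ.toHom) → ZMod 2 := fun x => c ⟨e x.1, x.2⟩
  have hc' : IsCoverCodeword (π.comp φ.toHom) c' := by
    refine (isCoverCodeword_iff_of_bijective b.bijective).2 fun w j hw => ?_
    refine Eq.trans ?_ (hc (e w) j hw)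
    rw [Finset.sum_filter]
    exact Finset.sum_congr rfl fun x _ => by simp [c', heb, φ]
  refine ⟨M, _, inferInstance, _, π.comp φ.toHom, c', hM,
    ⟨⟨hπ.1.1.comp e.surjective, fun y => ?_⟩, fun x => ⟨Set.toFinite _, ?_⟩⟩, hc', fun i => ?_⟩
  · exact (hπ.1.2 (e y)).comp (Equiv.bijOn e fun _ => Iff.rfl)
  · rw [← (hπ.2 x).2]
    exact Set.ncard_preimage_of_injective_subset_range (s := π ⁻¹' {x}) e.injective (by simp)
  · rw [unscaledPseudoCodeword_eq_of_bijective b.bijective, unscaledPseudoCodeword,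
      Finset.sum_filter]
    exact Finset.sum_congr rfl fun x _ => by simp [c', heb, φ]

variable {α : Type*} [DecidableEq α] (H) (σ : I → J → Equiv.Perm α)

/-- The lift of a parity-check matrix in which every entry `H j i` is multiplied by the permutation
matrix of `σ i j`. -/
def liftMatrix : Matrix (J × α) (I × α) (ZMod 2) :=
  fun y x => if σ x.1 y.1 x.2 = y.2 then H y.1 x.1 else 0

variable {H} in
theorem liftMatrix_eq_one_iff {j : J} {t : α} {i : I} {a : α} :
    liftMatrix H σ (j, t) (i, a) = 1 ↔ H j i = 1 ∧ σ i j a = t := by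
  by_cases h : σ i j a = t <;> simp [liftMatrix, h]

theorem liftMatrix_mulVec [Fintype I] [Fintype α] (c : I × α → ZMod 2) (j : J) (t : α) :
    (liftMatrix H σ).mulVec c (j, t) = ∑ i, H j i * c (i, (σ i j).symm t) := by
  simp only [Matrix.mulVec, dotProduct, liftMatrix, Fintype.sum_prod_type, ← Equiv.eq_symm_apply,
    ite_mul, zero_mul, Finset.sum_ite_eq', Finset.mem_univ, if_true]

/-- The projection of the Tanner graph of a lift onto the original Tanner graph. -/
def liftProjection : tannerGraph (liftMatrix H σ) →g tannerGraph H where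
  toFun := Sum.map Prod.fst Prod.fst
  map_rel' {x y} h := by
    rcases x with ⟨i, a⟩ | ⟨j, t⟩ <;> rcases y with ⟨i', a'⟩ | ⟨j', t'⟩
    exacts [h, ((liftMatrix_eq_one_iff σ).1 h).1, ((liftMatrix_eq_one_iff σ).1 h).1, h]

theorem isCover_liftProjection [Nonempty α] : IsCover (liftProjection H σ) := by
  refine isCover_iff.2 ⟨Prod.fst_surjective.sumMap Prod.fst_surjective, ?_⟩
  rintro (⟨i, a⟩ | ⟨j, t⟩) (i' | j') h
  · exact h.elim
  · refine ⟨.inr (j', σ i j' a), ⟨(liftMatrix_eq_one_iff σ).2 ⟨h, rfl⟩, rfl⟩, ?_⟩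
    rintro (x | ⟨j, t⟩) ⟨hadj, heq⟩
    · exact (Sum.inl_ne_inr heq).elim
    · obtain rfl : j = j' := Sum.inr_injective heq
      rw [((liftMatrix_eq_one_iff σ).1 hadj).2]
  · refine ⟨.inl (i', (σ i' j).symm t), ⟨(liftMatrix_eq_one_iff σ).2 ⟨h, by simp⟩, rfl⟩, ?_⟩
    rintro (⟨i, a⟩ | y) ⟨hadj, heq⟩
    · obtain rfl : i = i' := Sum.inl_injective heq
      rw [← ((liftMatrix_eq_one_iff σ).1 hadj).2, Equiv.symm_apply_apply]
    · exact (Sum.inr_ne_inl heq).elim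
  · exact h.elim

theorem isMCover_liftProjection [Nonempty α] [Finite α] :
    IsMCover (Nat.card α) (liftProjection H σ) := by
  refine ⟨isCover_liftProjection H σ, fun x => ?_⟩
  obtain ⟨f, hf, hx⟩ : ∃ f : α → (I × α) ⊕ (J × α), f.Injective ∧
      liftProjection H σ ⁻¹' {x} = Set.range f := by
    rcases x with i | j
    · refine ⟨fun a => .inl (i, a), fun a b h => by simpa using h, ?_⟩
      ext (⟨i', a⟩ | ⟨j, t⟩) <;> simp [liftProjection, eq_comm]
    · refine ⟨fun t => .inr (j, t), fun a b h => by simpa using h, ?_⟩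
      ext (⟨i, a⟩ | ⟨j', t⟩) <;> simp [liftProjection, eq_comm]
  rw [hx]
  refine ⟨Set.toFinite _, ?_⟩
  rw [← Set.image_univ, Set.ncard_image_of_injective _ hf, Set.ncard_univ]

variable {H σ}

theorem isUnscaledPseudoCodeword_of_liftMatrix_mulVec_eq_zero [Fintype I] [Finite J] [Nonempty α]
    [Fintype α] {c : I × α → ZMod 2} (hc : (liftMatrix H σ).mulVec c = 0) :
    IsUnscaledPseudoCodeword H fun i => ∑ a, (c (i, a)).val := by
  classical
  have := Fintype.ofFinite J
  let b : I × α → BitNode (liftProjection H σ) := fun x => ⟨.inl x, x.1, rfl⟩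
  have hb : b.Bijective := by
    refine ⟨fun x y h => Sum.inl_injective (congrArg Subtype.val h), ?_⟩
    rintro ⟨x | y, i, hi⟩
    exacts [⟨x, rfl⟩, (Sum.inr_ne_inl hi).elim]
  let c' : BitNode (liftProjection H σ) → ZMod 2 := fun x => Sum.elim c 0 x.1
  have hc' : IsCoverCodeword (liftProjection H σ) c' := by
    refine (isCoverCodeword_iff_of_bijective hb).2 ?_
    rintro (x | y) j hj
    · exact (Sum.inl_ne_inr hj).elim
    have hval : ∀ a b : ZMod 2, (if a = 1 then b else 0) = a * b := by decide
    refine Eq.trans (Finset.sum_congr rfl fun x _ => ?_) (congrFun hc y)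
    rw [← hval]
    congr!
  convert (isMCover_liftProjection H σ).isUnscaledPseudoCodeword Nat.card_pos hc' with i
  rw [unscaledPseudoCodeword_eq_of_bijective hb, Fintype.sum_prod_type]
  simp [b, c', liftProjection]

theorem exists_perm_apply_mem_iff {α : Type*} [Finite α] {A B : Finset α} (h : A.card = B.card) :
    ∃ σ : Equiv.Perm α, ∀ a, σ a ∈ B ↔ a ∈ A := by
  classical
  refine ⟨(Finset.equivOfCardEq h).extendSubtype, fun a => ⟨fun ha => ?_, fun ha => ?_⟩⟩
  · by_contra ha'
    exact Equiv.extendSubtype_not_mem (Finset.equivOfCardEq h) a ha' ha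
  · exact Equiv.extendSubtype_mem _ _ ha

theorem isUnscaledPseudoCodeword_card {α : Type*} [Finite α] [Nonempty α] [Finite I] [Finite J]
    {A : I → Finset α} {T : J → α → Finset I} (hmem : ∀ j t, ∀ i ∈ T j t, H j i = 1)
    (heven : ∀ j t, Even (T j t).card)
    (hcard : ∀ j i, H j i = 1 → (A i).card = Nat.card {t // i ∈ T j t}) :
    IsUnscaledPseudoCodeword H fun i => (A i).card := by
  classical
  have := Fintype.ofFinite I
  have := Fintype.ofFinite α
  have hperm (i : I) (j : J) : ∃ σ : Equiv.Perm α, H j i = 1 →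
      ∀ a, i ∈ T j (σ a) ↔ a ∈ A i := by
    by_cases hij : H j i = 1
    · obtain ⟨σ, hσ⟩ := exists_perm_apply_mem_iff (B := Finset.univ.filter (i ∈ T j ·)) <|
        (hcard j i hij).trans (by rw [Nat.card_eq_fintype_card, Fintype.card_subtype])
      exact ⟨σ, fun _ a => by simpa using hσ a⟩
    · exact ⟨1, fun h => absurd h hij⟩
  choose σ hσ using hperm
  let c : I × α → ZMod 2 := fun x => if x.2 ∈ A x.1 then 1 else 0
  have hc : (liftMatrix H σ).mulVec c = 0 := by
    ext ⟨j, t⟩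
    calc (liftMatrix H σ).mulVec c (j, t)
      _ = ∑ i, if i ∈ T j t then 1 else 0 := by
        rw [liftMatrix_mulVec]
        refine Finset.sum_congr rfl fun i _ => ?_
        by_cases hij : H j i = 1
        · simp [c, hij, ← hσ i j hij]
        · have hi : i ∉ T j t := fun hi => hij (hmem j t i hi)
          have hval : ∀ a : ZMod 2, a ≠ 1 → a = 0 := by decide
          simp [hi, hval _ hij]
      _ = ((T j t).card : ZMod 2) := by simp
      _ = 0 := ZMod.natCast_eq_zero_iff_even.2 (heven j t)
  convert isUnscaledPseudoCodeword_of_liftMatrix_mulVec_eq_zero hc with i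
  simp [c, apply_ite ZMod.val, ZMod.val_one]

theorem isUnscaledPseudoCodeword_of_mem_balanced [DecidableEq I] [Finite I] [Finite J]
    (hH : IsCycleCode H) {s : Multiset I} (hs : s ∈ balanced (normalGraph H)) :
    IsUnscaledPseudoCodeword H (s.count ·) := by
  let M := s.card + 1
  have hle (j : J) : (s.filter (H j · = 1)).card ≤ M :=
    (Multiset.card_le_card (s.filter_le _)).trans s.card.le_succ
  choose T hTeven hTsum using fun j =>
    exists_even_finsets_sum_eq ((mem_balanced_normalGraph_iff hH).1 hs j) (hle j)
  choose A _ hA using fun i => Finset.exists_subset_card_eq (s := (Finset.univ : Finset (Fin M)))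
    (n := s.count i) (by simpa [M] using (s.count_le_card i).trans s.card.le_succ)
  simp only [← hA]
  refine isUnscaledPseudoCodeword_card (fun j t i hi => ?_) hTeven fun j i hij => ?_
  · have hi' : i ∈ ∑ t, (T j t).val := Multiset.mem_sum.2 ⟨t, Finset.mem_univ t, hi⟩
    rw [hTsum] at hi'
    exact (Multiset.mem_filter.1 hi').2
  · rw [hA, ← Multiset.count_filter_of_pos (p := (H j · = 1)) hij, ← hTsum j,
      Multiset.count_sum', Nat.card_eq_fintype_card, Fintype.card_subtype, Finset.card_filter]
    exact Finset.sum_congr rfl fun t _ => Multiset.count_eq_of_nodup (T j t).nodup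

theorem isUnscaledPseudoCodeword_count_iff [DecidableEq I] [Finite I] [Finite J]
    (hH : IsCycleCode H) {s : Multiset I} :
    IsUnscaledPseudoCodeword H (s.count ·) ↔ s ∈ balanced (normalGraph H) := by
  refine ⟨?_, isUnscaledPseudoCodeword_of_mem_balanced hH⟩
  rintro ⟨M, W, _, Y, π, c, -, hπ, hc, hs⟩
  obtain rfl : s = bitMultiset c := by
    ext i
    refine (hs i).trans ?_
    rw [← count_bitMultiset]
    congr!
  exact bitMultiset_mem_balanced hH hπ.1 hc

end Lifts

section GeometricProducts

open MvPowerSeries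
variable {E R : Type*} [CommRing R]

theorem add_mem_multiples_iff {m n : E →₀ ℕ} (hm : m ≠ 0) :
    m + n ∈ AddSubmonoid.multiples m ↔ n ∈ AddSubmonoid.multiples m := by
  refine ⟨?_, add_mem (AddSubmonoid.mem_multiples m)⟩
  rintro ⟨_ | k, hk⟩
  · exact absurd (add_eq_zero.1 (hk.symm.trans (zero_nsmul m))).1 hm
  · exact ⟨k, add_left_cancel ((succ_nsmul' m k).symm.trans hk)⟩

theorem constantCoeff_one_sub_monomial {m : E →₀ ℕ} (hm : m ≠ 0) :
    constantCoeff (1 - monomial m (1 : R)) = ((1 : Rˣ) : R) := by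
  classical
  rw [map_sub, ← coeff_zero_eq_constantCoeff_apply, ← coeff_zero_eq_constantCoeff_apply,
    coeff_monomial, if_neg hm.symm, coeff_zero_one, sub_zero, Units.val_one]

open scoped Classical in
theorem coeff_invOfUnit_one_sub_monomial {m : E →₀ ℕ} (hm : m ≠ 0) (n : E →₀ ℕ) :
    coeff n (invOfUnit (1 - monomial m (1 : R)) 1) =
      if n ∈ AddSubmonoid.multiples m then 1 else 0 := by
  let f : MvPowerSeries E R := fun n => if n ∈ AddSubmonoid.multiples m then 1 else 0
  have hf : ∀ n, coeff n f = if n ∈ AddSubmonoid.multiples m then 1 else 0 := fun _ => rfl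
  have hmul : (1 - monomial m (1 : R)) * f = 1 := by
    ext n
    rw [sub_mul, one_mul, map_sub, coeff_one]
    by_cases hmn : m ≤ n
    · obtain ⟨n, rfl⟩ := exists_add_of_le hmn
      have hne : m + n ≠ 0 := fun h => hm (add_eq_zero.1 h).1
      rw [coeff_add_monomial_mul, one_mul, hf, hf, if_congr (add_mem_multiples_iff hm) rfl rfl,
        sub_self, if_neg hne]
    · have hzero : n ∈ AddSubmonoid.multiples m ↔ n = 0 := by
        refine ⟨?_, fun h => h ▸ zero_mem _⟩
        rintro ⟨_ | k, rfl⟩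
        · exact zero_nsmul m
        · exact absurd (by simp [succ_nsmul']) hmn
      rw [coeff_monomial_mul, if_neg hmn, sub_zero, hf, if_congr hzero rfl rfl]
  rw [← hf, left_inv_eq_right_inv (invOfUnit_mul _ 1 (constantCoeff_one_sub_monomial hm)) hmul]

section Nonneg

variable [LinearOrder R] [IsStrictOrderedRing R]

/-- The power series `f` has nonnegative coefficients, and `S` is the set of the exponents of the
monomials that occur in it. -/
def IsNonnegWithSupport (f : MvPowerSeries E R) (S : AddSubmonoid (E →₀ ℕ)) : Prop :=
  ∀ n, 0 ≤ coeff n f ∧ (coeff n f ≠ 0 ↔ n ∈ S)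

theorem IsNonnegWithSupport.one : IsNonnegWithSupport (1 : MvPowerSeries E R) ⊥ := by
  classical
  intro n
  rw [coeff_one, AddSubmonoid.mem_bot]
  split_ifs with h <;> simp [h]

theorem IsNonnegWithSupport.mul {f g : MvPowerSeries E R} {S T : AddSubmonoid (E →₀ ℕ)}
    (hf : IsNonnegWithSupport f S) (hg : IsNonnegWithSupport g T) :
    IsNonnegWithSupport (f * g) (S ⊔ T) := by
  classical
  intro n
  have hnonneg : ∀ x ∈ Finset.HasAntidiagonal.antidiagonal n, 0 ≤ coeff x.1 f * coeff x.2 g :=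
    fun x _ => mul_nonneg (hf x.1).1 (hg x.2).1
  rw [coeff_mul, Ne, Finset.sum_eq_zero_iff_of_nonneg hnonneg, AddSubmonoid.mem_sup]
  refine ⟨Finset.sum_nonneg hnonneg, ?_⟩
  simp only [Finset.HasAntidiagonal.mem_antidiagonal, mul_eq_zero, not_forall, not_or,
    ← (hf _).2, ← (hg _).2]
  exact ⟨fun ⟨x, hx, hxf, hxg⟩ => ⟨x.1, hxf, x.2, hxg, hx⟩,
    fun ⟨a, ha, b, hb, hab⟩ => ⟨(a, b), hab, ha, hb⟩⟩

theorem isNonnegWithSupport_geometric {m : E →₀ ℕ} (hm : m ≠ 0) : IsNonnegWithSupport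
    (invOfUnit (1 - monomial m (1 : R)) 1) (AddSubmonoid.multiples m) := by
  intro n
  rw [coeff_invOfUnit_one_sub_monomial hm]
  split_ifs with h <;> simp [h]

variable {ι : Type*} {m : ι → E →₀ ℕ}

theorem isNonnegWithSupport_prod_geometric (hm : ∀ c, m c ≠ 0) (F : Finset ι) :
    IsNonnegWithSupport (∏ c ∈ F, invOfUnit (1 - monomial (m c) (1 : R)) 1)
      (AddSubmonoid.closure (m '' F)) := by
  classical
  induction F using Finset.induction_on with
  | empty => simpa using IsNonnegWithSupport.one
  | insert c F hc ih =>
    rw [Finset.prod_insert hc, Finset.coe_insert, Set.image_insert_eq, Set.insert_eq,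
      AddSubmonoid.closure_union, ← AddSubmonoid.multiples_eq_closure]
    exact (isNonnegWithSupport_geometric (hm c)).mul ih

end Nonneg

variable [TopologicalSpace R] {ι : Type*} {m : ι → E →₀ ℕ}

theorem multipliable_geometric (hm : ∀ c, m c ≠ 0) (hfin : ∀ n, {c | m c ≤ n}.Finite) :
    Multipliable fun c => invOfUnit (1 - monomial (m c) (1 : R)) 1 := by
  classical
  let f : ι → MvPowerSeries E R := fun c => invOfUnit (1 - monomial (m c) (1 : R)) 1
  have hf : f = fun c => 1 + monomial (m c) (1 : R) * f c := by
    refine funext fun c => sub_eq_iff_eq_add.1 ?_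
    rw [← one_sub_mul, mul_invOfUnit _ _ (constantCoeff_one_sub_monomial (hm c))]
  change Multipliable f
  rw [hf]
  refine multipliable_one_add_of_summable_prod
    (WithPiTopology.summable_iff_summable_coeff.2 fun n => summable_of_hasFiniteSupport ?_)
  refine (hfin n).toFinset.powerset.finite_toSet.subset fun F hF => ?_
  refine Finset.mem_coe.2 (Finset.mem_powerset.2 fun c hc => (hfin n).mem_toFinset.2 ?_)
  contrapose! hF
  rw [Function.notMem_support, ← Finset.mul_prod_erase F _ hc, mul_assoc, coeff_monomial_mul]
  exact if_neg hF

theorem coeff_tprod_geometric_ne_zero_iff [LinearOrder R] [IsStrictOrderedRing R]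
    [DiscreteTopology R] (hm : ∀ c, m c ≠ 0) (hfin : ∀ n, {c | m c ≤ n}.Finite) {n : E →₀ ℕ} :
    coeff n (∏' c, invOfUnit (1 - monomial (m c) (1 : R)) 1) ≠ 0 ↔
      n ∈ AddSubmonoid.closure (Set.range m) := by
  classical
  have hprod := (multipliable_geometric (R := R) hm hfin).hasProd
  rw [HasProd, SummationFilter.unconditional_filter,
    WithPiTopology.tendsto_iff_coeff_tendsto] at hprod
  obtain ⟨F₀, hF₀⟩ : ∃ F₀, ∀ F ≥ F₀, coeff n (∏ c ∈ F, invOfUnit (1 - monomial (m c) (1 : R)) 1) =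
      coeff n (∏' c, invOfUnit (1 - monomial (m c) (1 : R)) 1) := by
    simpa only [nhds_discrete, Filter.tendsto_pure, Filter.eventually_atTop] using hprod n
  have hsupp (F : Finset ι) := (isNonnegWithSupport_prod_geometric (R := R) hm F n).2
  constructor
  · intro h
    rw [← hF₀ F₀ le_rfl, hsupp] at h
    exact AddSubmonoid.closure_mono (Set.image_subset_range _ _) h
  · intro h
    obtain ⟨a, rfl⟩ := AddSubmonoid.mem_closure_range_iff.1 h
    rw [← hF₀ (F₀ ∪ a.support) Finset.subset_union_left, hsupp]
    exact sum_mem fun c hc => nsmul_mem (AddSubmonoid.subset_closure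
      (Set.mem_image_of_mem m (Finset.mem_union_right F₀ hc))) _

end GeometricProducts

section EdgeZeta

variable {V E : Type*} {G : Graph V E}

theorem IsBTCycle.of_flatten_replicate {l : List E} {r : ℕ} (hr : 2 ≤ r) (hl : IsCycle G l)
    (h : IsBTCycle G (List.replicate r l).flatten) : IsBTCycle G l := by
  obtain ⟨r, rfl⟩ := Nat.exists_eq_add_of_le' hr
  obtain ⟨-, hchain, -⟩ := h
  rw [IsBacktrackless, List.replicate_succ, List.replicate_succ, List.flatten_cons,
    List.flatten_cons, List.isChain_append] at hchain
  refine ⟨hl, hchain.1, fun htail => hchain.2.2 (l.head hl.1) ?_ (l.head hl.1) ?_ rfl⟩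
  · rw [← htail]
    exact List.head?_eq_some_head hl.1
  · rw [List.head?_append_of_ne_nil _ hl.1]
    exact List.head?_eq_some_head hl.1

theorem coe_flatten_replicate (r : ℕ) (l : List E) :
    ((List.replicate r l).flatten : Multiset E) = r • (l : Multiset E) := by
  induction r with
  | zero => simp
  | succ r ih => rw [List.replicate_succ, List.flatten_cons, ← Multiset.coe_add, ih, succ_nsmul']

theorem IsBTCycle.mem_closure_primeClasses {l : List E} (h : IsBTCycle G l) :
    ↑l ∈ AddSubmonoid.closure (Cycle.toMultiset '' primeClasses G) := by
  induction hn : l.length using Nat.strong_induction_on generalizing l with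
  | _ n ih =>
  by_cases hprim : IsPrimitive G l
  · exact AddSubmonoid.subset_closure ⟨l, ⟨l, rfl, h, hprim⟩, rfl⟩
  · obtain ⟨θ, r, hθ, hr, rfl⟩ := not_not.1 hprim
    have hlen : θ.length < n := by
      rw [← hn, ← Multiset.coe_card, ← Multiset.coe_card, coe_flatten_replicate,
        Multiset.card_nsmul]
      exact lt_mul_left (by simpa [List.length_pos_iff] using hθ.1) hr
    rw [coe_flatten_replicate]
    exact nsmul_mem (ih _ hlen (h.of_flatten_replicate hr hθ) rfl) r

theorem closure_primeClasses_eq_balanced (G : Graph V E) :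
    AddSubmonoid.closure (Cycle.toMultiset '' primeClasses G) = balanced G := by
  rw [← closure_isBTCycle_eq_balanced]
  apply le_antisymm
  · refine AddSubmonoid.closure_mono ?_
    rintro _ ⟨_, ⟨l, rfl, hl, -⟩, rfl⟩
    exact ⟨l, hl, rfl⟩
  · refine AddSubmonoid.closure_le.2 ?_
    rintro _ ⟨l, hl, rfl⟩
    exact hl.mem_closure_primeClasses

open scoped Classical in
/-- The exponent vector of the monomial of a cycle. -/
noncomputable def cycleExponent (c : Cycle E) : E →₀ ℕ := Multiset.toFinsupp c.toMultiset

@[simp]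
theorem toMultiset_cycleExponent (c : Cycle E) :
    Finsupp.toMultiset (cycleExponent c) = c.toMultiset := by
  classical
  exact Multiset.toFinsupp_toMultiset _

theorem cycleMonomial_eq_monomial (c : Cycle E) :
    cycleMonomial c = MvPowerSeries.monomial (cycleExponent c) 1 := by
  classical
  unfold cycleMonomial cycleExponent
  induction c.toMultiset using Multiset.induction_on with
  | empty => simp
  | cons e s ih =>
    rw [Multiset.map_cons, Multiset.prod_cons, ih, MvPowerSeries.X,
      MvPowerSeries.monomial_mul_monomial, ← Multiset.singleton_add, map_add,
      Multiset.toFinsupp_singleton, one_mul]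

theorem cycleExponent_ne_zero (c : primeClasses G) : cycleExponent c.1 ≠ 0 := by
  obtain ⟨_, l, rfl, hl, -⟩ := c
  intro h
  have hl0 := toMultiset_cycleExponent (l : Cycle E)
  rw [h, map_zero, Cycle.coe_toMultiset, eq_comm, Multiset.coe_eq_zero] at hl0
  exact hl.ne_nil hl0

theorem finite_setOf_cycleExponent_le (n : E →₀ ℕ) :
    {c : Cycle E | cycleExponent c ≤ n}.Finite := by
  classical
  have hlists : {l : List E | ↑l ≤ Finsupp.toMultiset n}.Finite := by
    refine ((Multiset.finite_toSet (Finsupp.toMultiset n).powerset).biUnion fun s _ =>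
      s.lists.finite_toSet).subset fun l hl => ?_
    exact Set.mem_biUnion (Multiset.mem_powerset.2 hl) ((Multiset.mem_lists_iff _ _).2 rfl)
  refine (hlists.image ((↑) : List E → Cycle E)).subset fun c hc => ?_
  induction c using Quotient.inductionOn with
  | _ l =>
    refine ⟨l, ?_, rfl⟩
    have := Finsupp.toMultiset_strictMono.monotone hc
    exact (toMultiset_cycleExponent (l : Cycle E)).symm.le.trans this

theorem zetaFactor_eq (G : Graph V E) : zetaFactor G = fun c : primeClasses G =>
    MvPowerSeries.invOfUnit (1 - MvPowerSeries.monomial (cycleExponent c.1) (1 : ℤ)) 1 :=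
  funext fun c => by rw [zetaFactor, cycleMonomial_eq_monomial]

theorem finite_primeClasses_cycleExponent_le (G : Graph V E) (n : E →₀ ℕ) :
    {c : primeClasses G | cycleExponent c.1 ≤ n}.Finite :=
  (finite_setOf_cycleExponent_le n).preimage Subtype.val_injective.injOn

theorem multipliable_zetaFactor (G : Graph V E) : Multipliable (zetaFactor G) := by
  rw [zetaFactor_eq]
  exact multipliable_geometric cycleExponent_ne_zero (finite_primeClasses_cycleExponent_le G)

theorem coeff_edgeZeta_ne_zero_iff {n : E →₀ ℕ} :
    MvPowerSeries.coeff n (edgeZeta G) ≠ 0 ↔ Finsupp.toMultiset n ∈ balanced G := by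
  classical
  rw [edgeZeta, zetaFactor_eq, coeff_tprod_geometric_ne_zero_iff cycleExponent_ne_zero
    (finite_primeClasses_cycleExponent_le G), ← closure_primeClasses_eq_balanced,
    ← AddSubmonoid.mem_map_iff_mem (f := Finsupp.toMultiset)
      Multiset.toFinsupp.symm.injective, AddMonoidHom.map_mclosure, ← Set.range_comp,
    Set.image_eq_range]
  simp only [Function.comp_def, toMultiset_cycleExponent]

end EdgeZeta

section RationalPoints

open scoped Matrix

theorem subset_convexHull_inter_of_isOpen_of_dense {E : Type*} [NormedAddCommGroup E]
    [NormedSpace ℝ E] [FiniteDimensional ℝ E] {U D : Set E} (hU : IsOpen U) (hD : Dense D) :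
    U ⊆ convexHull ℝ (U ∩ D) := by
  rcases U.eq_empty_or_nonempty with rfl | hne
  · exact Set.empty_subset _
  have hclosure : U ⊆ closure (U ∩ D) := hD.open_subset_closure_inter hU
  have hspan : affineSpan ℝ (U ∩ D) = ⊤ := by
    rw [eq_top_iff, ← hU.affineSpan_eq_top hne, affineSpan_le]
    exact hclosure.trans (closure_minimal (subset_affineSpan ℝ _)
      (AffineSubspace.closed_of_finiteDimensional _))
  have hinterior := interior_convexHull_nonempty_iff_affineSpan_eq_top.2 hspan
  calc U ⊆ interior (closure (convexHull ℝ (U ∩ D))) :=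
        hU.subset_interior_iff.2 (hclosure.trans (closure_mono (subset_convexHull ℝ _)))
    _ = interior (convexHull ℝ (U ∩ D)) :=
        (convex_convexHull ℝ _).interior_closure_eq_interior_of_nonempty_interior hinterior
    _ ⊆ convexHull ℝ (U ∩ D) := interior_subset

theorem exists_linearIndependent_eq_sum_smul (K : Type*) {ι V : Type*} [DivisionRing K]
    [AddCommGroup V] [Module K V] [Finite ι] (v : ι → V) :
    ∃ (n : ℕ) (b : Fin n → V) (X : Matrix ι (Fin n) K),
      LinearIndependent K b ∧ ∀ i, v i = ∑ l, X i l • b l := by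
  let W := Submodule.span K (Set.range v)
  have : FiniteDimensional K W := FiniteDimensional.span_of_finite K (Set.finite_range v)
  let b := Module.finBasis K W
  let w (i : ι) : W := ⟨v i, Submodule.subset_span ⟨i, rfl⟩⟩
  refine ⟨_, fun l => b l, fun i l => b.repr (w i) l,
    b.linearIndependent.map' W.subtype W.ker_subtype, fun i => ?_⟩
  have hw := congrArg W.subtype (b.sum_repr (w i)).symm
  rw [map_sum] at hw
  simpa only [map_smul, Submodule.subtype_apply] using hw

variable {ι κ : Type*} [Finite κ]

/- Write `ω = X b` with `X` rational and the entries of `b` linearly independent over `ℚ`. An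
inequality that is tight at `ω` then holds with equality at `X y` for every `y`, and the other
ones hold at `X y` for all `y` near `b`. -/
theorem mem_convexHull_rational_of_nonneg_mulVec [Fintype ι] (A : Matrix κ ι ℚ) {ω : ι → ℝ}
    (hω : 0 ≤ A.map (Rat.castHom ℝ) *ᵥ ω) :
    ω ∈ convexHull ℝ ({x | 0 ≤ A.map (Rat.castHom ℝ) *ᵥ x} ∩
      Set.range fun (q : ι → ℚ) i => (q i : ℝ)) := by
  obtain ⟨n, b, X, hb, hωb⟩ := exists_linearIndependent_eq_sum_smul ℚ ω
  let φ : (Fin n → ℝ) →ₗ[ℝ] ι → ℝ := (X.map (Rat.castHom ℝ)).mulVecLin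
  have hφb : φ b = ω := by
    ext i
    simp [φ, hωb, Matrix.mulVec, dotProduct, Rat.smul_def]
  have hAφ (y : Fin n → ℝ) (k : κ) :
      (A.map (Rat.castHom ℝ) *ᵥ φ y) k = ∑ l, ((A * X) k l : ℝ) * y l := by
    rw [Matrix.mulVecLin_apply, Matrix.mulVec_mulVec, ← Matrix.map_mul]
    rfl
  let U : Set (Fin n → ℝ) :=
    {y | ∀ k, (A * X) k ≠ 0 → 0 < (A.map (Rat.castHom ℝ) *ᵥ φ y) k}
  have hU : IsOpen U := by
    simp only [U, hAφ, Set.ofPred_forall]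
    exact isOpen_iInter_of_finite fun k => isOpen_iInter_of_finite fun _ =>
      isOpen_lt continuous_const (by fun_prop)
  have hbU : b ∈ U := by
    refine fun k hk => lt_of_le_of_ne (hφb ▸ hω k) fun h => hk (funext fun l => ?_)
    rw [hAφ] at h
    exact Fintype.linearIndependent_iff.1 hb _ (by simpa [Rat.smul_def] using h.symm) l
  have hrat : Dense (Set.range fun (q : Fin n → ℚ) l => (q l : ℝ)) :=
    DenseRange.piMap fun _ => Rat.denseRange_cast
  have hbmem := Set.mem_image_of_mem φ (subset_convexHull_inter_of_isOpen_of_dense hU hrat hbU)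
  rw [φ.image_convexHull, hφb] at hbmem
  refine convexHull_mono ?_ hbmem
  rintro _ ⟨_, ⟨hyU, y, rfl⟩, rfl⟩
  refine ⟨fun k => ?_, X *ᵥ y, ?_⟩
  · by_cases hk : (A * X) k = 0
    · exact (hAφ _ k).ge.trans' (by simp [hk])
    · exact (hyU k hk).le
  · ext i
    simp [φ, Matrix.mulVec, dotProduct]

theorem exists_natCast_eq_mul {q : κ → ℚ} (hq : 0 ≤ q) :
    ∃ d : ℕ, d ≠ 0 ∧ ∃ n : κ → ℕ, ∀ k, (n k : ℚ) = d * q k := by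
  obtain ⟨d, hd⟩ := IsLocalization.exist_integer_multiples_of_finite (nonZeroDivisors ℤ) q
  choose z hz using hd
  refine ⟨d.1.natAbs, by simp, fun k => (z k).natAbs, fun k => ?_⟩
  have hzk : (z k : ℚ) = d.1 * q k := by simpa [Submonoid.smul_def] using hz k
  rw [Nat.cast_natAbs, Nat.cast_natAbs, Int.cast_abs, Int.cast_abs, hzk, abs_mul,
    abs_of_nonneg (hq k)]

end RationalPoints

section CountVectors

/-- The vector of the multiplicities of the elements of a multiset. -/
def countVector (E : Type*) [DecidableEq E] : Multiset E →+ E → ℝ :=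
  AddMonoidHom.pi fun e => (Nat.castAddMonoidHom ℝ).comp (Multiset.countAddMonoidHom e)

variable {V E : Type*} [DecidableEq E]

theorem exists_count_eq [Finite E] (p : E → ℕ) : ∃ s : Multiset E, (s.count ·) = p :=
  ⟨Finsupp.toMultiset (Finsupp.equivFunOnFinite.symm p), by ext; simp⟩

@[simp]
theorem countVector_apply (s : Multiset E) (e : E) :
    countVector E s e = s.count e :=
  rfl

theorem newtonPolyhedron_edgeZeta (G : Graph V E) :
    newtonPolyhedron (edgeZeta G) = convexHull ℝ (countVector E '' balanced G) := by
  rw [newtonPolyhedron]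
  congr 1
  ext x
  simp only [coeff_edgeZeta_ne_zero_iff]
  constructor
  · rintro ⟨n, hn, rfl⟩
    exact ⟨_, hn, by ext; simp⟩
  · rintro ⟨s, hs, rfl⟩
    exact ⟨Multiset.toFinsupp s, by simpa using hs, by ext; simp⟩

end CountVectors

section FundamentalCone

variable {J I : Type*} {H : Matrix J I (ZMod 2)} [Fintype I]

theorem mem_fundamentalCone_iff {ω : I → ℝ} : ω ∈ fundamentalCone H ↔
    0 ≤ ω ∧ ∀ j i, H j i = 1 → 2 * ω i ≤ ∑ i' with H j i' = 1, ω i' := by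
  classical
  refine and_congr Iff.rfl (forall₂_congr fun j i => forall_congr' fun hji => ?_)
  rw [← Finset.add_sum_erase (Finset.univ.filter (H j · = 1)) ω (by simpa using hji), two_mul,
    add_le_add_iff_left, ← Finset.filter_ne', Finset.filter_filter]

open scoped Classical in
/-- The matrix of the inequalities `0 ≤ ω i` and `2 * ω i ≤ ∑ i' with H j i' = 1, ω i'` that
define the fundamental cone. -/
noncomputable def coneMatrix (H : Matrix J I (ZMod 2)) :
    Matrix (I ⊕ {x : J × I // H x.1 x.2 = 1}) I ℚ :=
  Matrix.fromRows 1 <| Matrix.of fun x i =>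
    (if H x.1.1 i = 1 then 1 else 0) - if i = x.1.2 then 2 else 0

open scoped Matrix in
theorem fundamentalCone_eq_setOf_mulVec (H : Matrix J I (ZMod 2)) :
    fundamentalCone H = {ω | 0 ≤ (coneMatrix H).map (Rat.castHom ℝ) *ᵥ ω} := by
  classical
  ext ω
  rw [mem_fundamentalCone_iff]
  simp [coneMatrix, Pi.le_def, Matrix.mulVec, sub_mul, dotProduct,
    Matrix.one_apply, apply_ite (Rat.cast : ℚ → ℝ), Finset.sum_filter]

theorem convex_fundamentalCone (H : Matrix J I (ZMod 2)) : Convex ℝ (fundamentalCone H) := by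
  rw [fundamentalCone_eq_setOf_mulVec]
  exact (convex_Ici 0).linear_preimage (Matrix.mulVecLin _)

theorem smul_mem_fundamentalCone {c : ℝ} (hc : 0 ≤ c) {ω : I → ℝ} (hω : ω ∈ fundamentalCone H) :
    c • ω ∈ fundamentalCone H := by
  rw [fundamentalCone_eq_setOf_mulVec] at hω ⊢
  simpa [Matrix.mulVec_smul] using smul_nonneg hc hω

theorem card_filter_eq_sum_count [DecidableEq I] (P : I → Prop) [DecidablePred P]
    (s : Multiset I) : (s.filter P).card = ∑ i with P i, s.count i := by
  rw [← Multiset.sum_count_eq_card (s := Finset.univ.filter P) (by simp)]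
  exact Finset.sum_congr rfl fun i hi => Multiset.count_filter_of_pos (Finset.mem_filter.1 hi).2

theorem countVector_mem_fundamentalCone_iff [DecidableEq I] {s : Multiset I} :
    countVector I s ∈ fundamentalCone H ↔
      ∀ j i, H j i = 1 → 2 * s.count i ≤ (s.filter (H j · = 1)).card := by
  have hnonneg : 0 ≤ countVector I s := fun i => Nat.cast_nonneg (s.count i)
  rw [mem_fundamentalCone_iff, and_iff_right hnonneg]
  refine forall₂_congr fun j i => forall_congr' fun _ => ?_
  rw [card_filter_eq_sum_count]
  simp only [countVector_apply]
  norm_cast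

theorem mem_balanced_normalGraph_iff_mem_fundamentalCone [DecidableEq I] (hH : IsCycleCode H)
    {s : Multiset I} : s ∈ balanced (normalGraph H) ↔
      (∀ j, Even (s.filter (H j · = 1)).card) ∧ countVector I s ∈ fundamentalCone H := by
  simp only [mem_balanced_normalGraph_iff hH, mem_distinctPairs_iff, forall_and,
    countVector_mem_fundamentalCone_iff, Multiset.count_filter]
  refine and_congr_right fun _ => forall₂_congr fun j i => ?_
  split_ifs with h <;> simp [h]

theorem ratCast_mem_convexHull_balanced [DecidableEq I] (hH : IsCycleCode H) {q : I → ℚ}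
    (hq : (fun i => (q i : ℝ)) ∈ fundamentalCone H) : (fun i => (q i : ℝ)) ∈
      convexHull ℝ (countVector I '' balanced (normalGraph H)) := by
  have hq0 : 0 ≤ q := fun i => Rat.cast_nonneg.1 (hq.1 i)
  obtain ⟨d, hd, n, hn⟩ := exists_natCast_eq_mul hq0
  obtain ⟨s, rfl⟩ := exists_count_eq n
  have hqs : (fun i => (q i : ℝ)) = (2 * d : ℝ)⁻¹ • countVector I (2 • s) := by
    ext i
    have hsi : (s.count i : ℝ) = d * q i := by exact_mod_cast hn i
    have hd' : (d : ℝ) ≠ 0 := Nat.cast_ne_zero.2 hd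
    rw [Pi.smul_apply, countVector_apply, Multiset.count_nsmul, smul_eq_mul]
    push_cast
    rw [hsi]
    field_simp
  have hs : 2 • s ∈ balanced (normalGraph H) := by
    refine (mem_balanced_normalGraph_iff_mem_fundamentalCone hH).2 ⟨fun j => ?_, ?_⟩
    · rw [Multiset.filter_nsmul, Multiset.card_nsmul]
      exact even_two_mul _
    · have hsq : countVector I (2 • s) = (2 * d : ℝ) • fun i => (q i : ℝ) := by
        rw [hqs, smul_inv_smul₀ (by positivity)]
      exact hsq ▸ smul_mem_fundamentalCone (by positivity) hq
  have hzero : 0 ∈ convexHull ℝ (countVector I '' balanced (normalGraph H)) :=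
    subset_convexHull ℝ _ ⟨0, zero_mem _, map_zero _⟩
  rw [hqs]
  refine (convex_convexHull ℝ _).smul_mem_of_zero_mem hzero
    (subset_convexHull ℝ _ ⟨_, hs, rfl⟩) ⟨by positivity, inv_le_one_of_one_le₀ ?_⟩
  exact_mod_cast Nat.one_le_iff_ne_zero.2 (mul_ne_zero two_ne_zero hd)

theorem convexHull_balanced_eq_fundamentalCone [DecidableEq I] [Finite J] (hH : IsCycleCode H) :
    convexHull ℝ (countVector I '' balanced (normalGraph H)) = fundamentalCone H := by
  apply subset_antisymm
  · refine convexHull_min ?_ (convex_fundamentalCone H)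
    rintro _ ⟨s, hs, rfl⟩
    exact ((mem_balanced_normalGraph_iff_mem_fundamentalCone hH).1 hs).2
  · intro ω hω
    rw [fundamentalCone_eq_setOf_mulVec] at hω
    have hmem := mem_convexHull_rational_of_nonneg_mulVec _ hω
    rw [← fundamentalCone_eq_setOf_mulVec] at hmem
    refine convexHull_min ?_ (convex_convexHull ℝ _) hmem
    rintro _ ⟨hq, q, rfl⟩
    exact ratCast_mem_convexHull_balanced hH hq

end FundamentalCone

section EdgeCounts

variable {V E : Type*} [DecidableEq E] {G : Graph V E} {s : Multiset E}

theorem mem_balanced_iff_exists_count_eq_sum : s ∈ balanced G ↔ ∃ Γ : Multiset (List E),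
    (∀ γ ∈ Γ, IsBTCycle G γ) ∧ ∀ e, s.count e = (Γ.map fun γ => γ.count e).sum := by
  rw [← closure_isBTCycle_eq_balanced]
  constructor
  · intro hs
    induction hs using AddSubmonoid.closure_induction with
    | mem s hs =>
      obtain ⟨γ, hγ, rfl⟩ := hs
      exact ⟨{γ}, by simpa using hγ, by simp⟩
    | zero => exact ⟨0, by simp, by simp⟩
    | add s t _ _ ihs iht =>
      obtain ⟨Γ, hΓ, hs⟩ := ihs
      obtain ⟨Δ, hΔ, ht⟩ := iht
      refine ⟨Γ + Δ, fun γ hγ => (Multiset.mem_add.1 hγ).elim (hΓ γ) (hΔ γ), fun e => ?_⟩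
      rw [Multiset.count_add, hs, ht, Multiset.map_add, Multiset.sum_add]
  · rintro ⟨Γ, hΓ, hs⟩
    have hsum : s = (Γ.map Multiset.ofList).sum := by
      ext e
      simp [hs, Multiset.count_sum]
    rw [hsum]
    refine multiset_sum_mem _ fun t ht => ?_
    obtain ⟨γ, hγ, rfl⟩ := Multiset.mem_map.1 ht
    exact AddSubmonoid.subset_closure ⟨γ, hΓ γ hγ, rfl⟩

theorem mem_balanced_and_isConnectedEdgeSet_iff_exists_count_eq :
    s ∈ balanced G ∧ IsConnectedEdgeSet G {e | 0 < s.count e} ↔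
      ∃ γ, IsBTCycle G γ ∧ ∀ e, s.count e = γ.count e := by
  simp only [Multiset.count_pos, ← exists_isBTCycle_coe_eq_iff, Multiset.ext, Multiset.coe_count,
    eq_comm]

end EdgeCounts

end CycleCode

theorem mainTheorem2 {J I : Type*} [Fintype J] [Fintype I] [DecidableEq I]
    (H : Matrix J I (ZMod 2)) (hH : CycleCode.IsCycleCode H) :
    -- unscaled pseudo-codewords are the edge counts of combinations of cycles
    (∀ p : I → ℕ, CycleCode.IsUnscaledPseudoCodeword H p ↔
      ∃ Γ : Multiset (List I), (∀ γ ∈ Γ, CycleCode.IsBTCycle (CycleCode.normalGraph H) γ) ∧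
        ∀ i, p i = (Γ.map fun γ => γ.count i).sum) ∧
    -- a single cycle suffices exactly when the support is nonempty and connected
    (∀ p : I → ℕ,
      (CycleCode.IsUnscaledPseudoCodeword H p ∧
        CycleCode.IsConnectedEdgeSet (CycleCode.normalGraph H) {i | 0 < p i}) ↔
      ∃ γ : List I, CycleCode.IsBTCycle (CycleCode.normalGraph H) γ ∧ ∀ i, p i = γ.count i) ∧
    -- the product that defines the edge zeta function converges
    Multipliable (CycleCode.zetaFactor (CycleCode.normalGraph H)) ∧
    -- `p ↦ u ^ p` is a bijection from the unscaled pseudo-codewords to the monomials of `ζ_N`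
    Set.BijOn (fun p : I → ℕ => Finsupp.equivFunOnFinite.symm p)
      {p | CycleCode.IsUnscaledPseudoCodeword H p}
      {m | MvPowerSeries.coeff m (CycleCode.edgeZeta (CycleCode.normalGraph H)) ≠ 0} ∧
    -- the Newton polyhedron is the fundamental cone
    CycleCode.newtonPolyhedron (CycleCode.edgeZeta (CycleCode.normalGraph H)) =
      CycleCode.fundamentalCone H := by
  refine ⟨fun p => ?_, fun p => ?_, CycleCode.multipliable_zetaFactor _,
    Finsupp.equivFunOnFinite.symm.bijOn fun p => ?_, ?_⟩
  · obtain ⟨s, rfl⟩ := CycleCode.exists_count_eq p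
    rw [CycleCode.isUnscaledPseudoCodeword_count_iff hH]
    exact CycleCode.mem_balanced_iff_exists_count_eq_sum
  · obtain ⟨s, rfl⟩ := CycleCode.exists_count_eq p
    rw [CycleCode.isUnscaledPseudoCodeword_count_iff hH]
    exact CycleCode.mem_balanced_and_isConnectedEdgeSet_iff_exists_count_eq
  · obtain ⟨s, rfl⟩ := CycleCode.exists_count_eq p
    have hs : Finsupp.equivFunOnFinite.symm (s.count ·) = Multiset.toFinsupp s := by ext; rfl
    rw [Set.mem_ofPred_eq, Set.mem_ofPred_eq, CycleCode.isUnscaledPseudoCodeword_count_iff hH, hs,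
      CycleCode.coeff_edgeZeta_ne_zero_iff, Multiset.toFinsupp_toMultiset]
  · rw [CycleCode.newtonPolyhedron_edgeZeta, CycleCode.convexHull_balanced_eq_fundamentalCone hH]
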